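/- Let $(\Omega,\mathcal F,\Pr)$ be a probability space and let $[m]=\{1,\dots,m\}$. Let $\{W(k)\}_{k\ge 0}$ be an independent sequence of random $m\times m$ row-stochastic matrices. Suppose that there is a vector $\pi\in\mathbb{R}^m$ with all entries positive such that $\pi^T\mathbb{E}[W(k)]=\pi^T$ for all $k\ge 0$ (a common steady state $\pi>0$ in expectation), and that there is $\gamma>0$ such that $$\mathbb{E}[W_{ii}(k)W_{ij}(k)+W_{jj}(k)W_{ji}(k)]\ \ge\ \gamma\,\mathbb{E}[W_{ij}(k)+W_{ji}(k)]\qquad\text{for all } k\ge 0 \text{ and } i\ne j$$ (the feedback property). Let $\{F(k)\}_{k\ge0}$ be a uniform link-failure process independent of the process $\{W(k)\}$, that is, a sequence of random $m\times m$ matrices with entries in $\{0,1\}$ such that for each fixed $k$ the entries $F_{ij}(k)$, $i\neq j$, are independent and identically distributed, and the matrices $F(0),F(1),\dots$ are independent. Let $p_k=\Pr(F_{ij}(k)=1)$ for $i\ne j$, and define the link-failure model $$U(k)=W(k)\odot(ee^T-F(k))+\mathrm{diag}\big([W(k)\odot F(k)]e\big),$$ where $\odot$ is the entrywise product and $e$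 is the all-ones vector. For $S\subset[m]$ write $W_S(k)=\sum_{i\in S,\,j\notin S}(W_{ij}(k)+W_{ji}(k))$. Call $\{U(k)\}$ ergodic if, almost surely, for every $t_0\ge0$ and every initial vector $x(t_0)\in\mathbb{R}^m$, the solution of $x(k+1)=U(k)x(k)$, $k\ge t_0$, satisfies $\lim_{k\to\infty}(x_i(k)-x_j(k))=0$ for all $i,j\in[m]$. Then the following are equivalent: 1. $\{U(k)\}$ is ergodic; 2. $\sum_{k=0}^\infty(1-p_k)\,\mathbb{E}[W_S(k)]=\infty$ for every nonempty proper subset $S$ of $[m]$; 3. almost surely, $\sum_{k=0}^\infty(1-p_k)\,W_S(k)=\infty$ for every nonempty proper subset $S$ of $[m]$. -/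

import Mathlib

open MeasureTheory ProbabilityTheory Filter Topology
open scoped Matrix

namespace RandomChain

/-- `A_S = ∑_{i ∈ S, j ∉ S} (A_ij + A_ji)`. -/
def cutFlow {m : ℕ} (A : Matrix (Fin m) (Fin m) ℝ) (S : Finset (Fin m)) : ℝ :=
  ∑ i ∈ S, ∑ j ∈ Sᶜ, (A i j + A j i)

/-- A deterministic chain `{A(k)}` is ergodic if, for every starting time `t₀` and every solution of
`x(k+1) = A(k) x(k)`, `k ≥ t₀`, all the differences `x_i(k) - x_j(k)` tend to `0`. -/
def IsErgodicChain {m : ℕ} (A : ℕ → Matrix (Fin m) (Fin m) ℝ) : Prop :=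
  ∀ (t₀ : ℕ) (x : ℕ → Fin m → ℝ), (∀ k, t₀ ≤ k → x (k + 1) = A k *ᵥ x k) →
    ∀ i j, Tendsto (fun k => x k i - x k j) atTop (𝓝 0)

section

variable {Ω : Type*} [MeasurableSpace Ω] {m : ℕ}

/-- A random model: a process of row-stochastic matrices with measurable entries. -/
structure IsRandomModel (W : ℕ → Ω → Matrix (Fin m) (Fin m) ℝ) : Prop where
  measurable : ∀ k i j, Measurable (fun ω => W k ω i j)
  stochastic : ∀ k ω, W k ω ∈ Matrix.rowStochastic ℝ (Fin m)

/-- The matrices `X(0), X(1), …` are independent (a matrix being regarded as the family of its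
entries, with the product σ-algebra). -/
def IsIndependent (X : ℕ → Ω → Matrix (Fin m) (Fin m) ℝ) (P : Measure Ω) : Prop :=
  iIndepFun (β := fun _ : ℕ => Fin m → Fin m → ℝ) (fun k ω i j => X k ω i j) P

/-- The matrix processes `{X(k)}` and `{Y(k)}` are independent of each other. -/
def AreIndependent (X Y : ℕ → Ω → Matrix (Fin m) (Fin m) ℝ) (P : Measure Ω) : Prop :=
  IndepFun (β := ℕ → Fin m → Fin m → ℝ) (γ := ℕ → Fin m → Fin m → ℝ)
    (fun ω k i j => X k ω i j) (fun ω k i j => Y k ω i j) P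

/-- A random model is ergodic if almost every realization is an ergodic chain. -/
def IsErgodic (W : ℕ → Ω → Matrix (Fin m) (Fin m) ℝ) (P : Measure Ω) : Prop :=
  ∀ᵐ ω ∂P, IsErgodicChain (fun k => W k ω)

/-- The entrywise expectation of a random matrix. -/
noncomputable def expectedMatrix (X : Ω → Matrix (Fin m) (Fin m) ℝ) (P : Measure Ω) :
    Matrix (Fin m) (Fin m) ℝ :=
  Matrix.of fun i j => ∫ ω, X ω i j ∂P

/-- `πᵀ E[W(k)] = πᵀ` for all `k`. -/
def HasCommonSteadyState (W : ℕ → Ω → Matrix (Fin m) (Fin m) ℝ) (P : Measure Ω)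
    (π : Fin m → ℝ) : Prop :=
  ∀ k, π ᵥ* expectedMatrix (W k) P = π

/-- The feedback property. -/
def HasFeedback (W : ℕ → Ω → Matrix (Fin m) (Fin m) ℝ) (P : Measure Ω) : Prop :=
  ∃ γ : ℝ, 0 < γ ∧ ∀ k i j, i ≠ j →
    γ * ∫ ω, (W k ω i j + W k ω j i) ∂P ≤
      ∫ ω, (W k ω i i * W k ω i j + W k ω j j * W k ω j i) ∂P

/-- A uniform link-failure process: a binary matrix process, independent in time, such that for
each fixed time the off-diagonal entries are independent and identically distributed. -/
structure IsUniformLinkFailure (F : ℕ → Ω → Matrix (Fin m) (Fin m) ℝ) (P : Measure Ω) :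
    Prop where
  measurable : ∀ k i j, Measurable (fun ω => F k ω i j)
  binary : ∀ k ω i j, F k ω i j = 0 ∨ F k ω i j = 1
  indep_entries : ∀ k, iIndepFun
    (fun (e : {e : Fin m × Fin m // e.1 ≠ e.2}) ω => F k ω e.1.1 e.1.2) P
  identDistrib : ∀ k i j i' j', i ≠ j → i' ≠ j' →
    IdentDistrib (fun ω => F k ω i j) (fun ω => F k ω i' j') P P
  indep_time : IsIndependent F P

end

/-- `U(k) = W(k) ⊙ (e eᵀ - F(k)) + diag([W(k) ⊙ F(k)] e)`, with `⊙` the entrywise product and `e`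
the all-ones vector. -/
def linkFailureModel {Ω : Type*} {m : ℕ} (W F : ℕ → Ω → Matrix (Fin m) (Fin m) ℝ) :
    ℕ → Ω → Matrix (Fin m) (Fin m) ℝ :=
  fun k ω => W k ω ⊙ (Matrix.vecMulVec 1 1 - F k ω) + Matrix.diagonal ((W k ω ⊙ F k ω) *ᵥ 1)

end RandomChain

/-! Everything rests on a comparison between two quantities along a solution: the flow across a cut
and the disagreement `∑ A_ij (x_i - x_j)²`.

Finite flow prevents merging. After a time at which the remaining flow across `S` is small, start
from the indicator of `Sᶜ`: the two groups can only drift by a multiple of that flow, so they stay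
apart (`not_isErgodicChain_of_summable_cutFlow`). If the expected flow is finite, the flow is finite
almost surely, hence ergodicity forces infinite expected flow.

Conversely, for an independent model with steady state `π > 0` and feedback, `E ∑ π_i x_i²` is a
Lyapunov function whose decrease dominates the expected disagreement (`integral_sum_sq_add_le`), so
the total disagreement is almost surely finite. Infinite expected flow becomes almost surely
infinite flow by independence (`ae_tendsto_sum_atTop_of_iIndepFun`). A deterministic bootstrap,
`tendsto_sub_of_summable_disagreement`, then shows that a persistent gap would make the disagreement
dominate the flow across a fixed cut, which is impossible.

The link-failure model inherits independence, `π` and the feedback constant `γ`, and its expected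
flows are those of `W` times `1 - p k`. The almost sure form of the criterion follows by applying
the same divergence lemma to the weighted flows of `W`. -/

namespace RandomChain

/-! ### Deterministic chains: cut flow, drift and disagreement. -/

section Deterministic

variable {m : ℕ}

lemma cutFlow_nonneg {A : Matrix (Fin m) (Fin m) ℝ} (hA : A ∈ Matrix.rowStochastic ℝ (Fin m))
    (S : Finset (Fin m)) : 0 ≤ cutFlow A S :=
  Finset.sum_nonneg fun i _ => Finset.sum_nonneg fun j _ => add_nonneg (hA.1 i j) (hA.1 j i)

lemma cutFlow_compl (A : Matrix (Fin m) (Fin m) ℝ) (S : Finset (Fin m)) :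
    cutFlow A Sᶜ = cutFlow A S := by
  unfold cutFlow
  rw [compl_compl, Finset.sum_comm]
  exact Finset.sum_congr rfl fun i _ => Finset.sum_congr rfl fun j _ => add_comm _ _

lemma sum_compl_le_cutFlow {A : Matrix (Fin m) (Fin m) ℝ}
    (hA : A ∈ Matrix.rowStochastic ℝ (Fin m)) {S : Finset (Fin m)} {i : Fin m} (hi : i ∈ S) :
    ∑ j ∈ Sᶜ, A i j ≤ cutFlow A S := by
  calc ∑ j ∈ Sᶜ, A i j ≤ ∑ j ∈ Sᶜ, (A i j + A j i) :=
        Finset.sum_le_sum fun j _ => le_add_of_nonneg_right (hA.1 j i)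
    _ ≤ cutFlow A S := Finset.single_le_sum (f := fun i => ∑ j ∈ Sᶜ, (A i j + A j i))
        (fun i _ => Finset.sum_nonneg fun j _ => add_nonneg (hA.1 i j) (hA.1 j i)) hi

lemma cutFlow_le {A : Matrix (Fin m) (Fin m) ℝ} (hA : A ∈ Matrix.rowStochastic ℝ (Fin m))
    (S : Finset (Fin m)) : cutFlow A S ≤ 2 * m * m := by
  have h (i j) : A i j + A j i ≤ 2 := by
    linarith [Matrix.le_one_of_mem_rowStochastic hA (i := i) (j := j),
      Matrix.le_one_of_mem_rowStochastic hA (i := j) (j := i)]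
  have hn (i j) : 0 ≤ A i j + A j i := add_nonneg (hA.1 i j) (hA.1 j i)
  calc cutFlow A S ≤ ∑ i, ∑ j, (A i j + A j i) := by
        refine (Finset.sum_le_sum fun i _ => Finset.sum_le_univ_sum_of_nonneg (hn i)).trans ?_
        exact Finset.sum_le_univ_sum_of_nonneg fun i => Finset.sum_nonneg fun j _ => hn i j
    _ ≤ ∑ _i : Fin m, ∑ _j : Fin m, (2 : ℝ) :=
        Finset.sum_le_sum fun i _ => Finset.sum_le_sum fun j _ => h i j
    _ = 2 * m * m := by simp; ring

lemma abs_mulVec_le {A : Matrix (Fin m) (Fin m) ℝ} (hA : A ∈ Matrix.rowStochastic ℝ (Fin m))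
    {x : Fin m → ℝ} {C : ℝ} (hx : ∀ i, |x i| ≤ C) (i : Fin m) : |(A *ᵥ x) i| ≤ C := by
  calc |(A *ᵥ x) i| ≤ ∑ j, |A i j * x j| := by
        rw [Matrix.mulVec, dotProduct]
        exact Finset.abs_sum_le_sum_abs _ _
    _ ≤ ∑ j, A i j * C := by
        refine Finset.sum_le_sum fun j _ => ?_
        rw [abs_mul, abs_of_nonneg (hA.1 i j)]
        exact mul_le_mul_of_nonneg_left (hx j) (hA.1 i j)
    _ = C := by rw [← Finset.sum_mul, Matrix.sum_row_of_mem_rowStochastic hA, one_mul]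

lemma abs_le_of_isSolution {A : ℕ → Matrix (Fin m) (Fin m) ℝ}
    (hA : ∀ k, A k ∈ Matrix.rowStochastic ℝ (Fin m)) {x : ℕ → Fin m → ℝ}
    (hx : ∀ n, x (n + 1) = A n *ᵥ x n) {C : ℝ} (h0 : ∀ i, |x 0 i| ≤ C) (n : ℕ) (i : Fin m) :
    |x n i| ≤ C := by
  induction n generalizing i with
  | zero => exact h0 i
  | succ n ih => rw [hx]; exact abs_mulVec_le (hA n) ih i

/-- A row indexed by `S` averages values at most `M` over `S`; the weight it puts outside is at most
the cut flow, and there the values are at most `C ≤ M + 2 * C`. -/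
lemma mulVec_le_add_cutFlow {A : Matrix (Fin m) (Fin m) ℝ}
    (hA : A ∈ Matrix.rowStochastic ℝ (Fin m)) {x : Fin m → ℝ} {C M : ℝ} (hC : ∀ i, |x i| ≤ C)
    {S : Finset (Fin m)} (hM : ∀ i ∈ S, x i ≤ M) {i : Fin m} (hi : i ∈ S) :
    (A *ᵥ x) i ≤ M + 2 * C * cutFlow A S := by
  have hMC : -C ≤ M := (abs_le.1 (hC i)).1.trans (hM i hi)
  have hC0 : 0 ≤ C := (abs_nonneg _).trans (hC i)
  calc (A *ᵥ x) i = ∑ j ∈ S, A i j * x j + ∑ j ∈ Sᶜ, A i j * x j :=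
        (Finset.sum_add_sum_compl S _).symm
    _ ≤ ∑ j ∈ S, A i j * M + ∑ j ∈ Sᶜ, A i j * (M + 2 * C) := by
        refine add_le_add (Finset.sum_le_sum fun j hj => ?_) (Finset.sum_le_sum fun j _ => ?_)
        · exact mul_le_mul_of_nonneg_left (hM j hj) (hA.1 i j)
        · exact mul_le_mul_of_nonneg_left (by linarith [(abs_le.1 (hC j)).2]) (hA.1 i j)
    _ = (∑ j, A i j) * M + 2 * C * ∑ j ∈ Sᶜ, A i j := by
        rw [← Finset.sum_mul, ← Finset.sum_mul, ← Finset.sum_add_sum_compl S]; ring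
    _ ≤ M + 2 * C * cutFlow A S := by
        rw [Matrix.sum_row_of_mem_rowStochastic hA, one_mul]
        gcongr
        exact sum_compl_le_cutFlow hA hi

lemma le_add_sum_cutFlow {A : ℕ → Matrix (Fin m) (Fin m) ℝ}
    (hA : ∀ k, A k ∈ Matrix.rowStochastic ℝ (Fin m)) {x : ℕ → Fin m → ℝ}
    (hx : ∀ n, x (n + 1) = A n *ᵥ x n) {C a : ℝ} (hC : ∀ n i, |x n i| ≤ C)
    {S : Finset (Fin m)} (ha : ∀ i ∈ S, x 0 i ≤ a) (n : ℕ) {i : Fin m} (hi : i ∈ S) :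
    x n i ≤ a + 2 * C * ∑ l ∈ Finset.range n, cutFlow (A l) S := by
  induction n generalizing i with
  | zero => simpa using ha i hi
  | succ n ih =>
    rw [hx, Finset.sum_range_succ, mul_add, ← add_assoc]
    exact mulVec_le_add_cutFlow (hA n) (hC n) (fun i hi => ih hi) hi

lemma sub_sum_cutFlow_le {A : ℕ → Matrix (Fin m) (Fin m) ℝ}
    (hA : ∀ k, A k ∈ Matrix.rowStochastic ℝ (Fin m)) {x : ℕ → Fin m → ℝ}
    (hx : ∀ n, x (n + 1) = A n *ᵥ x n) {C b : ℝ} (hC : ∀ n i, |x n i| ≤ C)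
    {S : Finset (Fin m)} (hb : ∀ i ∉ S, b ≤ x 0 i) (n : ℕ) {i : Fin m} (hi : i ∉ S) :
    b - 2 * C * ∑ l ∈ Finset.range n, cutFlow (A l) S ≤ x n i := by
  -- The lower bound is the upper bound for `-x` on `Sᶜ`, since a cut and its complement carry the
  -- same flow.
  have h := le_add_sum_cutFlow (x := fun n => -x n) (C := C) (a := -b) (S := Sᶜ) hA
    (fun n => by rw [hx, Matrix.mulVec_neg]) (fun n i => by simpa using hC n i)
    (fun i hi => by simpa using hb i (by simpa using hi)) n (i := i) (by simpa using hi)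
  simp only [cutFlow_compl, Pi.neg_apply] at h
  linarith

/-- The solution of `x(k+1) = A(k) x(k)` started at time `0` from `v`. -/
def solution (A : ℕ → Matrix (Fin m) (Fin m) ℝ) (v : Fin m → ℝ) : ℕ → Fin m → ℝ
  | 0 => v
  | n + 1 => A n *ᵥ solution A v n

lemma eq_solution {A : ℕ → Matrix (Fin m) (Fin m) ℝ} {t₀ : ℕ} {x : ℕ → Fin m → ℝ}
    (hx : ∀ k, t₀ ≤ k → x (k + 1) = A k *ᵥ x k) (n : ℕ) :
    x (t₀ + n) = solution (fun k => A (t₀ + k)) (x t₀) n := by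
  induction n with
  | zero => rfl
  | succ n ih => rw [solution, ← ih, ← hx _ (by omega)]; rfl

lemma solution_eq_sum (A : ℕ → Matrix (Fin m) (Fin m) ℝ) (v : Fin m → ℝ) (n : ℕ) :
    solution A v n = ∑ l, v l • solution A (Pi.single l 1) n := by
  induction n with
  | zero =>
    ext i
    simp [solution, Finset.sum_apply, Pi.single_apply]
  | succ n ih => simp only [solution, ih, Matrix.mulVec_sum, Matrix.mulVec_smul]

/-- By linearity the basis vectors suffice. This leaves countably many pairs `(t₀, l)`, so that
almost sure statements about single solutions can be combined. -/
lemma isErgodicChain_of_solution_single {A : ℕ → Matrix (Fin m) (Fin m) ℝ}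
    (h : ∀ (t₀ : ℕ) (l i j : Fin m), Tendsto (fun n =>
      solution (fun k => A (t₀ + k)) (Pi.single l 1) n i -
        solution (fun k => A (t₀ + k)) (Pi.single l 1) n j) atTop (𝓝 0)) :
    IsErgodicChain A := by
  intro t₀ x hx i j
  rw [← tendsto_add_atTop_iff_nat t₀]
  have h' := tendsto_finsetSum Finset.univ fun l _ => (h t₀ l i j).const_mul (x t₀ l)
  simp only [mul_zero, Finset.sum_const_zero] at h'
  refine h'.congr fun n => ?_
  rw [add_comm n, eq_solution hx, solution_eq_sum]
  simp [Finset.sum_apply, mul_sub, Finset.sum_sub_distrib]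

/-- A chain whose total flow across some cut is finite is not ergodic. -/
theorem not_isErgodicChain_of_summable_cutFlow {A : ℕ → Matrix (Fin m) (Fin m) ℝ}
    (hA : ∀ k, A k ∈ Matrix.rowStochastic ℝ (Fin m)) {S : Finset (Fin m)} (hS : S.Nonempty)
    (hS' : S ≠ Finset.univ) (hsum : Summable fun k => cutFlow (A k) S) : ¬ IsErgodicChain A := by
  intro herg
  obtain ⟨i, hi⟩ := hS
  obtain ⟨j, hj⟩ : ∃ j, j ∉ S := by
    by_contra! h
    exact hS' (Finset.eq_univ_iff_forall.2 h)
  -- With `C = 1`, a tail below `1 / 8` moves each group by at most `1 / 4`: values starting at 0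
  -- and 1 stay at distance at least `1 / 2`.
  obtain ⟨T, hT⟩ := ((tendsto_sum_nat_add fun k => cutFlow (A k) S).eventually
    (gt_mem_nhds (show (0 : ℝ) < 1 / 8 by norm_num))).exists
  have hflow (n : ℕ) : ∑ l ∈ Finset.range n, cutFlow (A (T + l)) S ≤ 1 / 8 := by
    refine le_trans (le_of_eq ?_) ((((summable_nat_add_iff T).2 hsum).sum_le_tsum
      (Finset.range n) fun l _ => cutFlow_nonneg (hA _) S).trans hT.le)
    simp only [add_comm]
  set v : Fin m → ℝ := fun l => if l ∈ S then 0 else 1 with hv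
  set y := solution (fun k => A (T + k)) v with hy
  have hyC : ∀ n i, |y n i| ≤ 1 := abs_le_of_isSolution (fun k => hA (T + k)) (fun n => rfl)
    (fun i => by simp only [hy, solution, hv]; split_ifs <;> simp)
  have hlo (n : ℕ) : y n i ≤ 1 / 4 := by
    have := le_add_sum_cutFlow (fun k => hA (T + k)) (x := y) (fun n => rfl) hyC (a := 0) (S := S)
      (fun l hl => by simp [hy, solution, hv, hl]) n hi
    linarith [hflow n]
  have hhi (n : ℕ) : 3 / 4 ≤ y n j := by
    have := sub_sum_cutFlow_le (fun k => hA (T + k)) (x := y) (fun n => rfl) hyC (b := 1) (S := S)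
      (fun l hl => by simp [hy, solution, hv, hl]) n hj
    linarith [hflow n]
  have h := herg T (fun k => y (k - T)) (fun k hk => by
    obtain ⟨n, rfl⟩ := Nat.exists_eq_add_of_le hk
    rw [show T + n + 1 - T = n + 1 by omega, show T + n - T = n by omega]
    rfl) j i
  have := ge_of_tendsto' h (b := 1 / 2) fun k => by linarith [hlo (k - T), hhi (k - T)]
  norm_num at this

/-- Finitely many reals with spread at least `d` have a gap of length `d / m`. -/
lemma exists_gap {x : Fin m → ℝ} {d : ℝ} (hd : 0 < d) {i j : Fin m} (hij : d ≤ x j - x i) :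
    ∃ S : Finset (Fin m), S.Nonempty ∧ S ≠ Finset.univ ∧
      ∃ a, (∀ s ∈ S, x s ≤ a) ∧ ∀ s ∉ S, a + d / m ≤ x s := by
  classical
  have hm : (0 : ℝ) < m := by exact_mod_cast i.pos
  by_contra! h
  -- Without a gap, each of these sublevel sets with `n < m` gains a new point at the next level, so
  -- `S m` would have more than `m` elements.
  let S (n : ℕ) : Finset (Fin m) := Finset.univ.filter fun s => x s ≤ x i + n * (d / m)
  have hcard (n : ℕ) (hn : n ≤ m) : n + 1 ≤ (S n).card := by
    induction n with
    | zero => exact Finset.card_pos.2 ⟨i, by simp [S]⟩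
    | succ n ih =>
      have hnm : (n : ℝ) < m := by exact_mod_cast hn
      have hj : j ∉ S n := by
        simp only [S, Finset.mem_filter, Finset.mem_univ, true_and, not_le]
        have : n * (d / m) < d := by
          rw [mul_div_assoc', div_lt_iff₀ hm, mul_comm]
          exact mul_lt_mul_of_pos_left hnm hd
        linarith
      have hi : i ∈ S n := by
        simp only [S, Finset.mem_filter, Finset.mem_univ, true_and]
        exact le_add_of_nonneg_right (by positivity)
      obtain ⟨s, hs, hs'⟩ := h (S n) ⟨i, hi⟩ (fun hu => hj (hu ▸ Finset.mem_univ j)) (x i + n * (d / m)) (fun s hs => by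
          simpa [S] using hs)
      have hss : S n ⊂ S (n + 1) := by
        refine (Finset.ssubset_iff_of_subset fun t ht => ?_).2 ⟨s, ?_, hs⟩
        · simp only [S, Finset.mem_filter, Finset.mem_univ, true_and] at ht ⊢
          push_cast
          have : 0 < d / m := by positivity
          linarith
        · simp only [S, Finset.mem_filter, Finset.mem_univ, true_and]
          push_cast
          linarith
      have := Finset.card_lt_card hss
      have := ih (by omega)
      omega
  have h1 := hcard m le_rfl
  have h2 := (S m).card_le_univ
  rw [Fintype.card_fin] at h2
  omega

/-- `∑_{i,j} A_ij (x_i - x_j)²`. -/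
def disagreement (A : Matrix (Fin m) (Fin m) ℝ) (x : Fin m → ℝ) : ℝ :=
  ∑ i, ∑ j, A i j * (x i - x j) ^ 2

lemma disagreement_nonneg {A : Matrix (Fin m) (Fin m) ℝ}
    (hA : A ∈ Matrix.rowStochastic ℝ (Fin m)) (x : Fin m → ℝ) : 0 ≤ disagreement A x :=
  Finset.sum_nonneg fun i _ => Finset.sum_nonneg fun j _ => mul_nonneg (hA.1 i j) (sq_nonneg _)

lemma mul_cutFlow_le_disagreement {A : Matrix (Fin m) (Fin m) ℝ}
    (hA : A ∈ Matrix.rowStochastic ℝ (Fin m)) {x : Fin m → ℝ} {S : Finset (Fin m)} {ε : ℝ}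
    (hε : 0 ≤ ε) (h : ∀ i ∈ S, ∀ j ∉ S, ε ≤ x j - x i) :
    ε ^ 2 * cutFlow A S ≤ disagreement A x := by
  have hn (i j) : 0 ≤ A i j * (x i - x j) ^ 2 := mul_nonneg (hA.1 i j) (sq_nonneg _)
  calc ε ^ 2 * cutFlow A S
      = ∑ i ∈ S, ∑ j ∈ Sᶜ, (A i j * ε ^ 2 + A j i * ε ^ 2) := by
        simp only [cutFlow, Finset.mul_sum]
        exact Finset.sum_congr rfl fun i _ => Finset.sum_congr rfl fun j _ => by ring
    _ ≤ ∑ i ∈ S, ∑ j ∈ Sᶜ, (A i j * (x i - x j) ^ 2 + A j i * (x j - x i) ^ 2) := by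
        refine Finset.sum_le_sum fun i hi => Finset.sum_le_sum fun j hj => ?_
        have hij := h i hi j (by simpa using hj)
        have hsq : ε ^ 2 ≤ (x j - x i) ^ 2 := pow_le_pow_left₀ hε hij 2
        rw [← neg_sub (x j), neg_sq]
        exact add_le_add (mul_le_mul_of_nonneg_left hsq (hA.1 i j))
          (mul_le_mul_of_nonneg_left hsq (hA.1 j i))
    _ = ∑ i ∈ S, ∑ j ∈ Sᶜ, A i j * (x i - x j) ^ 2
          + ∑ i ∈ Sᶜ, ∑ j ∈ S, A i j * (x i - x j) ^ 2 := by
        rw [Finset.sum_comm (s := Sᶜ), ← Finset.sum_add_distrib]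
        exact Finset.sum_congr rfl fun i _ => Finset.sum_add_distrib
    _ ≤ ∑ i ∈ S, ∑ j, A i j * (x i - x j) ^ 2 + ∑ i ∈ Sᶜ, ∑ j, A i j * (x i - x j) ^ 2 :=
        add_le_add (Finset.sum_le_sum fun i _ => Finset.sum_le_univ_sum_of_nonneg (hn i))
          (Finset.sum_le_sum fun i _ => Finset.sum_le_univ_sum_of_nonneg (hn i))
    _ = disagreement A x := Finset.sum_add_sum_compl S _

/-- If the total disagreement along a solution is finite while the flow across every cut is
infinite, then all the coordinates of the solution merge. -/
theorem tendsto_sub_of_summable_disagreement {A : ℕ → Matrix (Fin m) (Fin m) ℝ}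
    (hA : ∀ k, A k ∈ Matrix.rowStochastic ℝ (Fin m)) {x : ℕ → Fin m → ℝ}
    (hx : ∀ n, x (n + 1) = A n *ᵥ x n) (hsum : Summable fun k => disagreement (A k) (x k))
    (hflow : ∀ S : Finset (Fin m), S.Nonempty → S ≠ Finset.univ →
      Tendsto (fun n => ∑ k ∈ Finset.range n, cutFlow (A k) S) atTop atTop) (i j : Fin m) :
    Tendsto (fun k => x k i - x k j) atTop (𝓝 0) := by
  have hm : (0 : ℝ) < m := by exact_mod_cast i.pos
  obtain ⟨C, hC⟩ : ∃ C, ∀ n i, |x n i| ≤ C :=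
    ⟨∑ i, |x 0 i|, abs_le_of_isSolution hA hx fun i =>
      Finset.single_le_sum (f := fun i => |x 0 i|) (fun _ _ => abs_nonneg _) (Finset.mem_univ i)⟩
  have hC0 : 0 ≤ C := (abs_nonneg _).trans (hC 0 i)
  rw [Metric.tendsto_atTop]
  by_contra! hcon
  obtain ⟨d, hd, hfreq⟩ := hcon
  -- Half of the gap `d / m` is to survive forever; `η` is chosen so that disagreement at most `η`
  -- allows only flow `f` with `4 * C * f ≤ ε`. The `+ 1` covers `C = 0`.
  set ε : ℝ := d / m / 2 with hε
  have hε0 : 0 < ε := by positivity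
  set η : ℝ := ε ^ 3 / (4 * C + 1) with hη
  have hη0 : 0 < η := by positivity
  obtain ⟨N, hN⟩ := eventually_atTop.1 ((tendsto_sum_nat_add fun k =>
    disagreement (A k) (x k)).eventually (gt_mem_nhds hη0))
  obtain ⟨T, hT, hTd⟩ := hfreq N
  have htail (n : ℕ) : ∑ l ∈ Finset.range n, disagreement (A (T + l)) (x (T + l)) ≤ η := by
    refine le_trans (le_of_eq ?_) ((((summable_nat_add_iff T).2 hsum).sum_le_tsum
      (Finset.range n) fun l _ => disagreement_nonneg (hA _) _).trans (hN T hT).le)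
    simp only [add_comm]
  obtain ⟨i', j', hij⟩ : ∃ i' j', d ≤ x T j' - x T i' := by
    rw [Real.dist_eq, sub_zero] at hTd
    rcases le_abs.1 hTd with h | h
    · exact ⟨j, i, h⟩
    · exact ⟨i, j, by linarith⟩
  obtain ⟨S, hS, hS', a, ha, hb⟩ := exists_gap hd hij
  -- Bootstrap: the inequality up to `n` bounds the past flow through `htail`, so the gap at time `T
  -- + n` is still at least `2 * ε - ε`, which gives the inequality for the next term.
  have key (n : ℕ) : ε ^ 2 * ∑ l ∈ Finset.range n, cutFlow (A (T + l)) S ≤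
      ∑ l ∈ Finset.range n, disagreement (A (T + l)) (x (T + l)) := by
    induction n with
    | zero => simp
    | succ n ih =>
      rw [Finset.sum_range_succ, Finset.sum_range_succ, mul_add]
      refine add_le_add ih (mul_cutFlow_le_disagreement (hA _) hε0.le fun s hs t ht => ?_)
      have hs' := le_add_sum_cutFlow (fun k => hA (T + k)) (x := fun k => x (T + k))
        (fun n => hx (T + n)) (fun n i => hC _ i) (by simpa using ha) n hs
      have ht' := sub_sum_cutFlow_le (fun k => hA (T + k)) (x := fun k => x (T + k))
        (fun n => hx (T + n)) (fun n i => hC _ i) (by simpa using hb) n ht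
      have hfl : 4 * C * ∑ l ∈ Finset.range n, cutFlow (A (T + l)) S ≤ ε := by
        have h1 := ih.trans (htail n)
        rw [hη, le_div_iff₀ (by positivity)] at h1
        set f := ∑ l ∈ Finset.range n, cutFlow (A (T + l)) S
        have hf : 0 ≤ f := Finset.sum_nonneg fun l _ => cutFlow_nonneg (hA _) S
        have h2 : ε ^ 2 * (f * (4 * C + 1)) ≤ ε ^ 2 * ε := by linarith [h1, pow_succ ε 2]
        have := le_of_mul_le_mul_left h2 (by positivity)
        linarith
      have : d / m = 2 * ε := by rw [hε]; ring
      linarith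
  have hinf := (tendsto_add_atTop_iff_nat T).2 (hflow S hS hS')
  obtain ⟨n, hn⟩ := (hinf.eventually_gt_atTop
    (∑ k ∈ Finset.range T, cutFlow (A k) S + η / ε ^ 2)).exists
  rw [add_comm n, Finset.sum_range_add] at hn
  have := (key n).trans (htail n)
  rw [← le_div_iff₀' (by positivity)] at this
  linarith

end Deterministic

/-! ### Series of nonnegative random variables. -/

section Series

variable {Ω : Type*} [MeasurableSpace Ω] {P : Measure Ω}

/-- Nonnegative functions whose integrals have bounded partial sums are almost surely summable. -/
lemma ae_summable_of_sum_integral_le {X : ℕ → Ω → ℝ} (hX : ∀ k ω, 0 ≤ X k ω)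
    (hint : ∀ k, Integrable (X k) P) {C : ℝ}
    (hC : ∀ n, ∑ k ∈ Finset.range n, ∫ ω, X k ω ∂P ≤ C) :
    ∀ᵐ ω ∂P, Summable fun k => X k ω := by
  have hlt : ∫⁻ ω, ∑' k, ENNReal.ofReal (X k ω) ∂P ≠ ⊤ := by
    rw [lintegral_tsum fun k => (hint k).1.aemeasurable.ennreal_ofReal]
    simp_rw [← ofReal_integral_eq_lintegral_ofReal (hint _) (.of_forall (hX _))]
    refine (lt_of_le_of_lt ?_ (ENNReal.ofReal_lt_top (r := C))).ne
    rw [ENNReal.tsum_eq_iSup_nat]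
    refine iSup_le fun n => ?_
    rw [← ENNReal.ofReal_sum_of_nonneg fun k _ => integral_nonneg (hX k)]
    exact ENNReal.ofReal_le_ofReal (hC n)
  have hmeas : AEMeasurable (fun ω => ∑' k, ENNReal.ofReal (X k ω)) P :=
    AEMeasurable.tsum fun k => (hint k).1.aemeasurable.ennreal_ofReal
  filter_upwards [ae_lt_top' hmeas hlt] with ω hω
  have := ENNReal.summable_toReal hω.ne
  simpa only [ENNReal.toReal_ofReal (hX _ ω)] using this

/-- A linear bound for `exp (-x)` on `[0, M]`, to be integrated termwise. -/
lemma exp_neg_le_one_sub_div {x M : ℝ} (hx : 0 ≤ x) (hM : x ≤ M) :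
    Real.exp (-x) ≤ 1 - x / (1 + M) := by
  calc Real.exp (-x) = (Real.exp x)⁻¹ := Real.exp_neg x
    _ ≤ (1 + x)⁻¹ := by
        gcongr
        linarith [Real.add_one_le_exp x]
    _ = 1 - x / (1 + x) := by field_simp; ring
    _ ≤ 1 - x / (1 + M) := by gcongr

/-- A series of independent uniformly bounded nonnegative random variables diverges almost surely
as soon as the series of expectations diverges. -/
lemma ae_tendsto_sum_atTop_of_iIndepFun {X : ℕ → Ω → ℝ} (hind : iIndepFun X P)
    (hmeas : ∀ k, Measurable (X k)) (h0 : ∀ k ω, 0 ≤ X k ω) {M : ℝ} (hM : ∀ k ω, X k ω ≤ M)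
    (hdiv : Tendsto (fun n => ∑ k ∈ Finset.range n, ∫ ω, X k ω ∂P) atTop atTop) :
    ∀ᵐ ω ∂P, Tendsto (fun n => ∑ k ∈ Finset.range n, X k ω) atTop atTop := by
  have := hind.isProbabilityMeasure
  obtain ⟨ω₀⟩ : Nonempty Ω := P.nonempty_of_neZero
  have hM0 : 0 ≤ M := (h0 0 ω₀).trans (hM 0 ω₀)
  have hint (k) : Integrable (X k) P := .of_mem_Icc 0 M (hmeas k).aemeasurable
    (.of_forall fun ω => ⟨h0 k ω, hM k ω⟩)
  have hexpint {Y : Ω → ℝ} (hY : Measurable Y) (hY0 : ∀ ω, 0 ≤ Y ω) :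
      Integrable (fun ω => Real.exp (-1 * Y ω)) P :=
    .of_mem_Icc 0 1 (by fun_prop) (.of_forall fun ω => ⟨(Real.exp_pos _).le, by
      simpa using hY0 ω⟩)
  -- By independence these factors multiply, so `E exp (-∑ X k)` is at most the exponential of minus
  -- the diverging sum of expectations over `1 + M`.
  have hmgf (k) : mgf (X k) P (-1) ≤ Real.exp (-((∫ ω, X k ω ∂P) / (1 + M))) := by
    calc mgf (X k) P (-1) ≤ ∫ ω, (1 - X k ω / (1 + M)) ∂P := by
          refine integral_mono (hexpint (hmeas k) (h0 k))
            ((integrable_const 1).sub ((hint k).div_const _)) fun ω => ?_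
          simpa using exp_neg_le_one_sub_div (h0 k ω) (hM k ω)
      _ = 1 - (∫ ω, X k ω ∂P) / (1 + M) := by
          rw [integral_sub (integrable_const 1) ((hint k).div_const _), integral_div]
          simp
      _ ≤ _ := by linarith [Real.add_one_le_exp (-((∫ ω, X k ω ∂P) / (1 + M)))]
  have hsum (n) : mgf (∑ k ∈ Finset.range n, X k) P (-1) ≤
      Real.exp (-((∑ k ∈ Finset.range n, ∫ ω, X k ω ∂P) / (1 + M))) := by
    rw [hind.mgf_sum hmeas, Finset.sum_div, ← Finset.sum_neg_distrib, Real.exp_sum]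
    exact Finset.prod_le_prod (fun k _ => mgf_nonneg) fun k _ => hmgf k
  have hlim : Tendsto (fun n => mgf (∑ k ∈ Finset.range n, X k) P (-1)) atTop (𝓝 0) := by
    refine squeeze_zero (fun n => mgf_nonneg) hsum (Real.tendsto_exp_atBot.comp ?_)
    exact tendsto_neg_atTop_atBot.comp (hdiv.atTop_div_const (by positivity))
  -- Chernoff at parameter `-1`: the event that all partial sums are at most `K` has probability at
  -- most `exp K` times the vanishing transform.
  have hbdd (K : ℕ) : ∀ᵐ ω ∂P, ∃ n, (K : ℝ) < ∑ k ∈ Finset.range n, X k ω := by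
    rw [ae_iff]
    simp only [not_exists, not_lt]
    rw [← measureReal_eq_zero_iff]
    refine le_antisymm (ge_of_tendsto' (x := atTop) (f := fun n =>
      Real.exp (-(-1) * K) * mgf (∑ k ∈ Finset.range n, X k) P (-1)) ?_ fun n => ?_)
      measureReal_nonneg
    · simpa using hlim.const_mul (Real.exp (-(-1) * K))
    · refine le_trans (measureReal_mono ?_) (measure_le_le_exp_mul_mgf (K : ℝ) (by norm_num) ?_)
      · intro ω hω
        simpa using hω n
      · refine hexpint (by fun_prop) fun ω => ?_
        rw [Finset.sum_apply]
        exact Finset.sum_nonneg fun k _ => h0 k ω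
  filter_upwards [ae_all_iff.2 hbdd] with ω hω
  refine tendsto_atTop_atTop_of_monotone (fun a b hab => Finset.sum_le_sum_of_subset_of_nonneg
    (Finset.range_mono hab) fun k _ _ => h0 k ω) fun b => ?_
  obtain ⟨K, hK⟩ := exists_nat_ge b
  obtain ⟨n, hn⟩ := hω K
  exact ⟨n, hK.trans hn.le⟩

end Series

/-! ### Pairing two independent families. -/

section Independence

variable {Ω ι : Type*} {α β : ι → Type*} [MeasurableSpace Ω] {P : Measure Ω}
  [∀ i, MeasurableSpace (α i)] [∀ i, MeasurableSpace (β i)]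

/-- Two mutually independent families, each made of independent random variables, can be paired
into a family of independent random variables. -/
lemma iIndepFun_prodMk {X : ∀ i, Ω → α i} {Y : ∀ i, Ω → β i} (hX : iIndepFun X P)
    (hY : iIndepFun Y P) (hXY : IndepFun (fun ω i => X i ω) (fun ω i => Y i ω) P)
    (hXm : ∀ i, Measurable (X i)) (hYm : ∀ i, Measurable (Y i)) :
    iIndepFun (fun i ω => (X i ω, Y i ω)) P := by
  classical
  rw [iIndepFun_iff_iIndep]
  -- Measurable rectangles form a π-system generating the product σ-algebra, so independence need
  -- only be checked on them; there, all the probabilities factor.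
  refine iIndepSets.iIndep (fun i => ((hXm i).prodMk (hYm i)).comap_le)
    (fun i => Set.preimage (fun ω => (X i ω, Y i ω)) '' (Set.image2 (· ×ˢ ·)
      {s : Set (α i) | MeasurableSet s} {t : Set (β i) | MeasurableSet t}))
    (fun i => isPiSystem_prod.comap _) (fun i => ?_) ?_
  · rw [← MeasurableSpace.comap_generateFrom, generateFrom_prod]
  rw [iIndepSets_iff]
  intro s f hf
  choose! g hg using hf
  have hg' (i) (hi : i ∈ s) : ∃ A : Set (α i), ∃ B : Set (β i), MeasurableSet A ∧
      MeasurableSet B ∧ f i = X i ⁻¹' A ∩ Y i ⁻¹' B := by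
    obtain ⟨⟨A, hA, B, hB, hAB⟩, hf⟩ := hg i hi
    exact ⟨A, B, hA, hB, by rw [← hf, ← hAB]; rfl⟩
  choose! A B hA hB hf using hg'
  have hsplit (i) (hi : i ∈ s) : P (f i) = P (X i ⁻¹' A i) * P (Y i ⁻¹' B i) := by
    rw [hf i hi]
    exact (hXY.comp (measurable_pi_apply i) (measurable_pi_apply i)).measure_inter_preimage_eq_mul
      _ _ (hA i hi) (hB i hi)
  have hinter : ⋂ i ∈ s, f i = (fun ω i => X i ω) ⁻¹' (⋂ i ∈ s, Function.eval i ⁻¹' A i) ∩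
      (fun ω i => Y i ω) ⁻¹' (⋂ i ∈ s, Function.eval i ⁻¹' B i) := by
    ext ω
    simp only [Set.mem_iInter, Set.mem_inter_iff, Set.mem_preimage, Function.eval]
    constructor
    · intro h
      exact ⟨fun i hi => by have := h i hi; rw [hf i hi] at this; exact this.1,
        fun i hi => by have := h i hi; rw [hf i hi] at this; exact this.2⟩
    · intro h i hi
      rw [hf i hi]
      exact ⟨h.1 i hi, h.2 i hi⟩
  rw [hinter, hXY.measure_inter_preimage_eq_mul _ _
    (Finset.measurableSet_biInter s fun i hi => measurable_pi_apply i (hA i hi))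
    (Finset.measurableSet_biInter s fun i hi => measurable_pi_apply i (hB i hi)),
    Finset.prod_congr rfl hsplit, Finset.prod_mul_distrib]
  congr 1
  · rw [Set.preimage_iInter₂]
    exact hX.meas_biInter fun i hi => ⟨A i, hA i hi, rfl⟩
  · rw [Set.preimage_iInter₂]
    exact hY.meas_biInter fun i hi => ⟨B i, hB i hi, rfl⟩

end Independence

/-! ### The quadratic Lyapunov inequality for one matrix. -/

section Lyapunov

variable {m : ℕ}

/-- With `d j = x l - x j`, the variance of `x` under `u` is `∑ u d² - (∑ u d)²`. As `d l = 0`,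
Cauchy–Schwarz over `j ≠ l`, of total weight `1 - u l`, bounds the last square by `(1 - u l) ∑ u
d²`. -/
lemma sq_sum_add_le_sum_sq {u x : Fin m → ℝ} (hu : ∀ i, 0 ≤ u i) (hsum : ∑ i, u i = 1)
    (l : Fin m) :
    (∑ i, u i * x i) ^ 2 + ∑ j, u l * u j * (x l - x j) ^ 2 ≤ ∑ i, u i * x i ^ 2 := by
  have hcs : (∑ j, u j * (x l - x j)) ^ 2 ≤ (1 - u l) * ∑ j, u j * (x l - x j) ^ 2 := by
    have h1 : ∑ j ∈ Finset.univ.erase l, u j = 1 - u l := by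
      rw [← hsum, ← Finset.add_sum_erase _ _ (Finset.mem_univ l)]; ring
    have h2 : ∑ j ∈ Finset.univ.erase l, u j * (x l - x j) = ∑ j, u j * (x l - x j) :=
      Finset.sum_erase _ (by simp)
    have h3 : ∑ j ∈ Finset.univ.erase l, u j * (x l - x j) ^ 2 = ∑ j, u j * (x l - x j) ^ 2 :=
      Finset.sum_erase _ (by simp)
    rw [← h1, ← h2, ← h3]
    exact Finset.sum_sq_le_sum_mul_sum_of_sq_le_mul _ (fun j _ => hu j)
      (fun j _ => mul_nonneg (hu j) (sq_nonneg _)) fun j _ => le_of_eq (by ring)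
  have e1 : ∑ j, u j * (x l - x j) = x l - ∑ j, u j * x j := by
    simp only [mul_sub, Finset.sum_sub_distrib, ← Finset.sum_mul, hsum, one_mul]
  have e2 : ∑ j, u j * (x l - x j) ^ 2 =
      x l ^ 2 - 2 * x l * ∑ j, u j * x j + ∑ j, u j * x j ^ 2 := by
    calc ∑ j, u j * (x l - x j) ^ 2
        = ∑ j, (u j * x l ^ 2 - 2 * x l * (u j * x j) + u j * x j ^ 2) :=
          Finset.sum_congr rfl fun j _ => by ring
      _ = _ := by
          rw [Finset.sum_add_distrib, Finset.sum_sub_distrib, ← Finset.sum_mul, hsum, one_mul,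
            Finset.mul_sum]
  have e3 : ∑ j, u l * u j * (x l - x j) ^ 2 = u l * ∑ j, u j * (x l - x j) ^ 2 := by
    rw [Finset.mul_sum]
    exact Finset.sum_congr rfl fun j _ => by ring
  rw [e3]
  rw [e1] at hcs
  nlinarith [hcs, e2]

/-- The variance bound for row `l` is used at the index `l` itself: this yields the products `A l l
* A l j`, which are what the feedback property controls. -/
lemma sum_mul_sq_mulVec_add_le {A : Matrix (Fin m) (Fin m) ℝ}
    (hA : A ∈ Matrix.rowStochastic ℝ (Fin m)) {π : Fin m → ℝ} {δ : ℝ} (hδ : 0 ≤ δ)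
    (hπ : ∀ i, δ ≤ π i) (x : Fin m → ℝ) :
    ∑ l, π l * (A *ᵥ x) l ^ 2 + δ * ∑ l, ∑ j, A l l * A l j * (x l - x j) ^ 2 ≤
      ∑ l, ∑ i, π l * (A l i * x i ^ 2) := by
  rw [Finset.mul_sum, ← Finset.sum_add_distrib]
  refine Finset.sum_le_sum fun l _ => ?_
  rw [← Finset.mul_sum]
  have h := sq_sum_add_le_sum_sq (x := x) (hA.1 l) (Matrix.sum_row_of_mem_rowStochastic hA l) l
  have hn : 0 ≤ ∑ j, A l l * A l j * (x l - x j) ^ 2 := Finset.sum_nonneg fun j _ =>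
    mul_nonneg (mul_nonneg (hA.1 l l) (hA.1 l j)) (sq_nonneg _)
  calc π l * (A *ᵥ x) l ^ 2 + δ * ∑ j, A l l * A l j * (x l - x j) ^ 2
      ≤ π l * (A *ᵥ x) l ^ 2 + π l * ∑ j, A l l * A l j * (x l - x j) ^ 2 := by
        gcongr
        exact hπ l
    _ ≤ π l * ∑ i, A l i * x i ^ 2 := by
        rw [← mul_add]
        exact mul_le_mul_of_nonneg_left h (hδ.trans (hπ l))

end Lyapunov

/-! ### Independent random models: expected decrease and ergodicity. -/

section Model

variable {Ω : Type*} [MeasurableSpace Ω] {P : Measure Ω} {m : ℕ}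
  {U : ℕ → Ω → Matrix (Fin m) (Fin m) ℝ}

lemma IsRandomModel.measurable_fun (hU : IsRandomModel U) (k : ℕ) :
    Measurable fun ω => (fun i j => U k ω i j : Fin m → Fin m → ℝ) :=
  measurable_pi_lambda _ fun i => measurable_pi_lambda _ fun j => hU.measurable k i j

lemma IsRandomModel.entry_nonneg (hU : IsRandomModel U) (k : ℕ) (ω : Ω) (i j : Fin m) :
    0 ≤ U k ω i j := (hU.stochastic k ω).1 i j

lemma IsRandomModel.entry_le_one (hU : IsRandomModel U) (k : ℕ) (ω : Ω) (i j : Fin m) :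
    U k ω i j ≤ 1 := Matrix.le_one_of_mem_rowStochastic (hU.stochastic k ω)

lemma IsRandomModel.integrable_entry [IsFiniteMeasure P] (hU : IsRandomModel U) (k : ℕ)
    (i j : Fin m) : Integrable (fun ω => U k ω i j) P :=
  .of_mem_Icc 0 1 (hU.measurable k i j).aemeasurable
    (.of_forall fun ω => ⟨hU.entry_nonneg k ω i j, hU.entry_le_one k ω i j⟩)

lemma IsRandomModel.integrable_entry_mul [IsFiniteMeasure P] (hU : IsRandomModel U) (k : ℕ)
    (i j i' j' : Fin m) : Integrable (fun ω => U k ω i j * U k ω i' j') P :=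
  .of_mem_Icc 0 1 ((hU.measurable k i j).mul (hU.measurable k i' j')).aemeasurable
    (.of_forall fun ω => ⟨mul_nonneg (hU.entry_nonneg k ω i j) (hU.entry_nonneg k ω i' j'),
      mul_le_one₀ (hU.entry_le_one k ω i j) (hU.entry_nonneg k ω i' j')
        (hU.entry_le_one k ω i' j')⟩)

lemma measurable_cutFlow (S : Finset (Fin m)) :
    Measurable fun A : Fin m → Fin m → ℝ => cutFlow (Matrix.of A) S := by
  unfold cutFlow
  simp only [Matrix.of_apply]
  fun_prop

lemma IsRandomModel.measurable_cutFlow (hU : IsRandomModel U) (k : ℕ) (S : Finset (Fin m)) :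
    Measurable fun ω => cutFlow (U k ω) S :=
  (RandomChain.measurable_cutFlow S).comp (hU.measurable_fun k)

lemma IsRandomModel.integrable_cutFlow [IsFiniteMeasure P] (hU : IsRandomModel U) (k : ℕ)
    (S : Finset (Fin m)) : Integrable (fun ω => cutFlow (U k ω) S) P :=
  .of_mem_Icc 0 (2 * m * m) (hU.measurable_cutFlow k S).aemeasurable
    (.of_forall fun ω => ⟨cutFlow_nonneg (hU.stochastic k ω) S, cutFlow_le (hU.stochastic k ω) S⟩)

lemma integral_cutFlow [IsFiniteMeasure P] (hU : IsRandomModel U) (k : ℕ) (S : Finset (Fin m)) :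
    ∫ ω, cutFlow (U k ω) S ∂P =
      ∑ i ∈ S, ∑ j ∈ Sᶜ, (∫ ω, U k ω i j ∂P + ∫ ω, U k ω j i ∂P) := by
  have h (i j) : Integrable (fun ω => U k ω i j + U k ω j i) P :=
    (hU.integrable_entry k i j).add (hU.integrable_entry k j i)
  unfold cutFlow
  rw [integral_finsetSum _ fun i _ => integrable_finsetSum _ fun j _ => h i j]
  refine Finset.sum_congr rfl fun i _ => ?_
  rw [integral_finsetSum _ fun j _ => h i j]
  exact Finset.sum_congr rfl fun j _ =>
    integral_add (hU.integrable_entry k i j) (hU.integrable_entry k j i)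

lemma measurable_solution (v : Fin m → ℝ) (n : ℕ) :
    Measurable fun A : ℕ → Fin m → Fin m → ℝ => solution (fun k => Matrix.of (A k)) v n := by
  induction n with
  | zero => exact measurable_const
  | succ n ih =>
    refine measurable_pi_lambda _ fun i => ?_
    simp only [solution, Matrix.mulVec, dotProduct, Matrix.of_apply]
    refine Finset.measurable_sum _ fun j _ => ?_
    exact Measurable.mul (by fun_prop) ((measurable_pi_apply j).comp ih)

lemma solution_congr {A B : ℕ → Matrix (Fin m) (Fin m) ℝ} (v : Fin m → ℝ) {n : ℕ}
    (h : ∀ k < n, A k = B k) : solution A v n = solution B v n := by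
  induction n with
  | zero => rfl
  | succ n ih => rw [solution, solution, ih fun k hk => h k (by omega), h n (by omega)]

/-- The state at time `n` of an independent model is independent of the matrix at time `n`. -/
lemma indepFun_solution (hU : IsRandomModel U) (hind : IsIndependent U P) (v : Fin m → ℝ)
    (n : ℕ) : IndepFun (fun ω => (fun i j => U n ω i j : Fin m → Fin m → ℝ))
      (fun ω => solution (fun k => U k ω) v n) P := by
  have h := iIndepFun.indepFun_finset (β := fun _ : ℕ => Fin m → Fin m → ℝ)
    (f := fun k ω i j => U k ω i j) {n} (Finset.range n) (by simp) hind fun k => hU.measurable_fun k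
  -- The state at time `n` depends only on the matrices before `n`; padding with zeros writes it as
  -- a measurable function of those alone.
  let ext (B : Finset.range n → Fin m → Fin m → ℝ) : ℕ → Fin m → Fin m → ℝ :=
    fun k => if hk : k ∈ Finset.range n then B ⟨k, hk⟩ else 0
  have hext : Measurable ext := by
    refine measurable_pi_lambda _ fun k => ?_
    by_cases hk : k ∈ Finset.range n
    · simpa only [ext, hk, dite_true] using measurable_pi_apply _
    · simpa only [ext, hk, dite_false] using measurable_const
  have h' := h.comp (measurable_pi_apply ⟨n, Finset.mem_singleton_self n⟩)
    ((measurable_solution v n).comp hext)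
  refine h'.congr (.of_forall fun ω => rfl) (.of_forall fun ω => ?_)
  refine solution_congr v fun k hk => ?_
  ext i j
  simp [ext, hk]

lemma IsRandomModel.measurable_solution (hU : IsRandomModel U) (v : Fin m → ℝ) (n : ℕ) :
    Measurable fun ω => solution (fun k => U k ω) v n :=
  (RandomChain.measurable_solution v n).comp
    (measurable_pi_lambda (fun ω k i j => U k ω i j) fun k => hU.measurable_fun k)

lemma IsRandomModel.abs_solution_le (hU : IsRandomModel U) {v : Fin m → ℝ} {C : ℝ}
    (hv : ∀ i, |v i| ≤ C) (n : ℕ) (ω : Ω) (i : Fin m) :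
    |solution (fun k => U k ω) v n i| ≤ C :=
  abs_le_of_isSolution (fun k => hU.stochastic k ω) (fun _ => rfl) hv n i

/-- Along an independent model with a positive common steady state and the feedback property, the
expectation of `∑ π_i x_i²` decreases at least by a fixed multiple of the disagreement. -/
lemma integral_sum_sq_add_le [IsProbabilityMeasure P] (hU : IsRandomModel U)
    (hind : IsIndependent U P) {π : Fin m → ℝ} {δ γ : ℝ} (hδ : 0 ≤ δ) (hπδ : ∀ i, δ ≤ π i)
    (hπ : HasCommonSteadyState U P π)
    (hγ : ∀ k i j, i ≠ j → γ * ∫ ω, (U k ω i j + U k ω j i) ∂P ≤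
      ∫ ω, (U k ω i i * U k ω i j + U k ω j j * U k ω j i) ∂P) (v : Fin m → ℝ) (n : ℕ) :
    ∫ ω, ∑ i, π i * solution (fun k => U k ω) v (n + 1) i ^ 2 ∂P +
        δ * γ * ∫ ω, disagreement (U n ω) (solution (fun k => U k ω) v n) ∂P ≤
      ∫ ω, ∑ i, π i * solution (fun k => U k ω) v n i ^ 2 ∂P := by
  set x : ℕ → Ω → Fin m → ℝ := fun n ω => solution (fun k => U k ω) v n with hxdef
  have hxm (n i) : Measurable fun ω => x n ω i :=
    (measurable_pi_apply i).comp (hU.measurable_solution v n)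
  obtain ⟨C, hC⟩ : ∃ C, ∀ n ω i, |x n ω i| ≤ C :=
    ⟨∑ i, |v i|, hU.abs_solution_le fun i =>
      Finset.single_le_sum (f := fun i => |v i|) (fun _ _ => abs_nonneg _) (Finset.mem_univ i)⟩
  have hsqint (n i) : Integrable (fun ω => x n ω i ^ 2) P :=
    .of_mem_Icc 0 (C ^ 2) ((hxm n i).pow_const 2).aemeasurable
      (.of_forall fun ω => ⟨sq_nonneg _, sq_le_sq' (abs_le.1 (hC n ω i)).1 (abs_le.1 (hC n ω i)).2⟩)
  have hdiffint (i j) : Integrable (fun ω => (x n ω i - x n ω j) ^ 2) P := by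
    refine .of_mem_Icc 0 ((2 * C) ^ 2) (((hxm n i).sub (hxm n j)).pow_const 2).aemeasurable
      (.of_forall fun ω => ⟨sq_nonneg _, ?_⟩)
    have h1 := abs_le.1 (hC n ω i)
    have h2 := abs_le.1 (hC n ω j)
    exact sq_le_sq' (by linarith) (by linarith)
  have hxind := indepFun_solution hU hind v n
  have hi1 (l i) : IndepFun (fun ω => U n ω l i) (fun ω => x n ω i ^ 2) P :=
    hxind.comp (φ := fun A : Fin m → Fin m → ℝ => A l i) (ψ := fun y : Fin m → ℝ => y i ^ 2)
      (by fun_prop) (by fun_prop)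
  have hi2 (l j) : IndepFun (fun ω => U n ω l l * U n ω l j)
      (fun ω => (x n ω l - x n ω j) ^ 2) P :=
    hxind.comp (φ := fun A : Fin m → Fin m → ℝ => A l l * A l j) (ψ := fun y : Fin m → ℝ => (y l - y j) ^ 2)
      (by fun_prop) (by fun_prop)
  have hi3 (l j) : IndepFun (fun ω => U n ω l j) (fun ω => (x n ω l - x n ω j) ^ 2) P :=
    hxind.comp (φ := fun A : Fin m → Fin m → ℝ => A l j)
      (ψ := fun y : Fin m → ℝ => (y l - y j) ^ 2) (by fun_prop) (by fun_prop)
  have hI1 (l i) : Integrable (fun ω => U n ω l i * x n ω i ^ 2) P :=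
    (hi1 l i).integrable_mul (hU.integrable_entry n l i) (hsqint n i)
  have hI2 (l j) :
      Integrable (fun ω => U n ω l l * U n ω l j * (x n ω l - x n ω j) ^ 2) P :=
    (hi2 l j).integrable_mul (hU.integrable_entry_mul n l l l j) (hdiffint l j)
  have hI3 (l j) : Integrable (fun ω => U n ω l j * (x n ω l - x n ω j) ^ 2) P :=
    (hi3 l j).integrable_mul (hU.integrable_entry n l j) (hdiffint l j)
  set e : Fin m → Fin m → ℝ := fun i j => ∫ ω, (x n ω i - x n ω j) ^ 2 ∂P with he
  have he0 (i j) : 0 ≤ e i j := integral_nonneg fun ω => sq_nonneg _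
  have hesymm (i j) : e i j = e j i := by
    simp only [he]
    exact integral_congr_ae (.of_forall fun ω => by ring)
  have hediag (i) : e i i = 0 := by simp [he]
  set a : Fin m → Fin m → ℝ := fun i j => ∫ ω, U n ω i j ∂P with ha
  set b : Fin m → Fin m → ℝ := fun i j => ∫ ω, U n ω i i * U n ω i j ∂P with hb
  have hdis : ∫ ω, disagreement (U n ω) (x n ω) ∂P = ∑ i, ∑ j, a i j * e i j := by
    unfold disagreement
    rw [integral_finsetSum _ fun i _ => integrable_finsetSum _ fun j _ => hI3 i j]
    refine Finset.sum_congr rfl fun i _ => ?_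
    rw [integral_finsetSum _ fun j _ => hI3 i j]
    exact Finset.sum_congr rfl fun j _ => (hi3 i j).integral_fun_mul_eq_mul_integral
      (hU.integrable_entry n i j).1 (hdiffint i j).1
  have hfb : ∫ ω, ∑ l, ∑ j, U n ω l l * U n ω l j * (x n ω l - x n ω j) ^ 2 ∂P =
      ∑ i, ∑ j, b i j * e i j := by
    rw [integral_finsetSum _ fun i _ => integrable_finsetSum _ fun j _ => hI2 i j]
    refine Finset.sum_congr rfl fun i _ => ?_
    rw [integral_finsetSum _ fun j _ => hI2 i j]
    exact Finset.sum_congr rfl fun j _ => (hi2 i j).integral_fun_mul_eq_mul_integral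
      (hU.integrable_entry_mul n i i i j).1 (hdiffint i j).1
  -- Independence of `U n` and `x n` separates the expectations, and stationarity of `π` then
  -- removes the matrix.
  have hpi : ∫ ω, ∑ l, ∑ i, π l * (U n ω l i * x n ω i ^ 2) ∂P =
      ∫ ω, ∑ i, π i * x n ω i ^ 2 ∂P := by
    rw [integral_finsetSum _ fun l _ => integrable_finsetSum _ fun i _ => (hI1 l i).const_mul _,
      integral_finsetSum _ fun i _ => (hsqint n i).const_mul _]
    have hrow (l) : ∫ ω, ∑ i, π l * (U n ω l i * x n ω i ^ 2) ∂P =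
        ∑ i, π l * a l i * ∫ ω, x n ω i ^ 2 ∂P := by
      rw [integral_finsetSum _ fun i _ => (hI1 l i).const_mul _]
      refine Finset.sum_congr rfl fun i _ => ?_
      rw [integral_const_mul, mul_assoc]
      congr 1
      exact (hi1 l i).integral_fun_mul_eq_mul_integral (hU.integrable_entry n l i).1 (hsqint n i).1
    simp_rw [hrow]
    rw [Finset.sum_comm]
    refine Finset.sum_congr rfl fun i _ => ?_
    rw [← Finset.sum_mul, integral_const_mul]
    congr 1
    simpa [Matrix.vecMul, dotProduct, expectedMatrix] using congrFun (hπ n) i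
  have hab (i j) : γ * (a i j + a j i) * e i j ≤ (b i j + b j i) * e i j := by
    rcases eq_or_ne i j with rfl | hij
    · simp [hediag]
    · refine mul_le_mul_of_nonneg_right ?_ (he0 i j)
      have := hγ n i j hij
      rwa [integral_add (hU.integrable_entry n i j) (hU.integrable_entry n j i),
        integral_add (hU.integrable_entry_mul n i i i j) (hU.integrable_entry_mul n j j j i)]
        at this
  -- Feedback only compares the sums over `(i, j)` and `(j, i)`; the symmetry of `e` makes this
  -- enough.
  have hsym (c : Fin m → Fin m → ℝ) :
      ∑ i, ∑ j, (c i j + c j i) * e i j = 2 * ∑ i, ∑ j, c i j * e i j := by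
    have : ∑ i, ∑ j, c j i * e i j = ∑ i, ∑ j, c i j * e i j := by
      rw [Finset.sum_comm]
      exact Finset.sum_congr rfl fun i _ => Finset.sum_congr rfl fun j _ => by rw [hesymm]
    simp only [add_mul, Finset.sum_add_distrib, this]
    ring
  have hcomp : γ * ∑ i, ∑ j, a i j * e i j ≤ ∑ i, ∑ j, b i j * e i j := by
    have h1 : ∑ i, ∑ j, γ * (a i j + a j i) * e i j ≤ ∑ i, ∑ j, (b i j + b j i) * e i j :=
      Finset.sum_le_sum fun i _ => Finset.sum_le_sum fun j _ => hab i j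
    have h2 : ∑ i, ∑ j, γ * (a i j + a j i) * e i j = γ * (2 * ∑ i, ∑ j, a i j * e i j) := by
      rw [← hsym, Finset.mul_sum]
      simp only [Finset.mul_sum, mul_assoc]
    rw [hsym, h2] at h1
    linarith
  have hJ1 : Integrable (fun ω => ∑ l, π l * x (n + 1) ω l ^ 2) P :=
    integrable_finsetSum _ fun i _ => (hsqint (n + 1) i).const_mul _
  have hJ2 : Integrable (fun ω => δ * ∑ l, ∑ j, U n ω l l * U n ω l j *
      (x n ω l - x n ω j) ^ 2) P :=
    (integrable_finsetSum _ fun i _ => integrable_finsetSum _ fun j _ => hI2 i j).const_mul δ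
  have hmono := integral_mono (hJ1.add hJ2)
    (integrable_finsetSum _ fun l _ => integrable_finsetSum _ fun i _ =>
      (hI1 l i).const_mul (π l))
    fun ω => sum_mul_sq_mulVec_add_le (hU.stochastic n ω) hδ hπδ (x n ω)
  rw [integral_add' hJ1 hJ2, integral_const_mul, hfb] at hmono
  rw [hdis]
  refine le_trans ?_ (hmono.trans hpi.le)
  rw [mul_assoc]
  gcongr

/-- Along an independent model with a positive common steady state and the feedback property, the
total disagreement is almost surely finite. -/
lemma ae_summable_disagreement [IsProbabilityMeasure P] (hU : IsRandomModel U)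
    (hind : IsIndependent U P) {π : Fin m → ℝ} (hπpos : ∀ i, 0 < π i)
    (hπ : HasCommonSteadyState U P π) (hfb : HasFeedback U P) (v : Fin m → ℝ) :
    ∀ᵐ ω ∂P, Summable fun n => disagreement (U n ω) (solution (fun k => U k ω) v n) := by
  obtain ⟨γ, hγ0, hγ⟩ := hfb
  obtain ⟨δ, hδ0, hδ⟩ : ∃ δ, 0 < δ ∧ ∀ i, δ ≤ π i := by
    rcases isEmpty_or_nonempty (Fin m) with h | h
    · exact ⟨1, one_pos, fun i => h.elim i⟩
    · obtain ⟨i, hi⟩ := Finite.exists_min π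
      exact ⟨π i, hπpos i, hi⟩
  have hc : 0 < δ * γ := mul_pos hδ0 hγ0
  set V : ℕ → ℝ := fun n => ∫ ω, ∑ i, π i * solution (fun k => U k ω) v n i ^ 2 ∂P with hV
  have hV0 (n) : 0 ≤ V n := integral_nonneg fun ω =>
    Finset.sum_nonneg fun i _ => mul_nonneg (hπpos i).le (sq_nonneg _)
  -- The one-step decreases telescope.
  have hbd (n : ℕ) : V n + δ * γ * ∑ k ∈ Finset.range n,
      ∫ ω, disagreement (U k ω) (solution (fun k => U k ω) v k) ∂P ≤ V 0 := by
    induction n with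
    | zero => simp
    | succ n ih =>
      have := integral_sum_sq_add_le hU hind hδ0.le hδ hπ hγ v n
      rw [Finset.sum_range_succ, mul_add]
      simp only [hV] at ih this ⊢
      linarith
  have hxm (n i) : Measurable fun ω => solution (fun k => U k ω) v n i :=
    (measurable_pi_apply i).comp (hU.measurable_solution v n)
  refine ae_summable_of_sum_integral_le (C := V 0 / (δ * γ))
    (fun k ω => disagreement_nonneg (hU.stochastic k ω) _) (fun n => ?_) fun n => ?_
  · refine integrable_finsetSum _ fun i _ => integrable_finsetSum _ fun j _ => ?_
    have hC := hU.abs_solution_le (v := v) (C := ∑ i, |v i|) fun i =>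
      Finset.single_le_sum (f := fun i => |v i|) (fun _ _ => abs_nonneg _) (Finset.mem_univ i)
    refine .of_mem_Icc 0 (1 * (2 * ∑ i, |v i|) ^ 2) ((hU.measurable n i j).mul
      (((hxm n i).sub (hxm n j)).pow_const 2)).aemeasurable (.of_forall fun ω =>
        ⟨mul_nonneg (hU.entry_nonneg n ω i j) (sq_nonneg _), ?_⟩)
    have h1 := abs_le.1 (hC n ω i)
    have h2 := abs_le.1 (hC n ω j)
    exact mul_le_mul (hU.entry_le_one n ω i j) (sq_le_sq' (by linarith) (by linarith))
      (sq_nonneg _) zero_le_one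
  · rw [le_div_iff₀' hc]
    linarith [hbd n, hV0 n]

lemma iIndepFun_cutFlow (hind : IsIndependent U P) (S : Finset (Fin m)) :
    iIndepFun (fun k ω => cutFlow (U k ω) S) P :=
  hind.comp (fun _ A => cutFlow (Matrix.of A) S) fun _ => measurable_cutFlow S

/-- An independent model with a positive common steady state, the feedback property and infinite
expected flow across every cut is ergodic. -/
theorem isErgodic_of_tendsto_sum_integral_cutFlow [IsProbabilityMeasure P] (hU : IsRandomModel U)
    (hind : IsIndependent U P) {π : Fin m → ℝ} (hπpos : ∀ i, 0 < π i)
    (hπ : HasCommonSteadyState U P π) (hfb : HasFeedback U P)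
    (hflow : ∀ S : Finset (Fin m), S.Nonempty → S ≠ Finset.univ →
      Tendsto (fun n => ∑ k ∈ Finset.range n, ∫ ω, cutFlow (U k ω) S ∂P) atTop atTop) :
    IsErgodic U P := by
  have h1 : ∀ᵐ ω ∂P, ∀ S : Finset (Fin m), S.Nonempty → S ≠ Finset.univ →
      Tendsto (fun n => ∑ k ∈ Finset.range n, cutFlow (U k ω) S) atTop atTop := by
    simp only [ae_all_iff]
    exact fun S hS hS' => ae_tendsto_sum_atTop_of_iIndepFun (iIndepFun_cutFlow hind S)
      (fun k => hU.measurable_cutFlow k S) (fun k ω => cutFlow_nonneg (hU.stochastic k ω) S)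
      (fun k ω => cutFlow_le (hU.stochastic k ω) S) (hflow S hS hS')
  have h2 : ∀ᵐ ω ∂P, ∀ (t₀ : ℕ) (l : Fin m), Summable fun n => disagreement (U (t₀ + n) ω)
      (solution (fun k => U (t₀ + k) ω) (Pi.single l 1) n) := by
    simp only [ae_all_iff]
    intro t₀ l
    obtain ⟨γ, hγ0, hγ⟩ := hfb
    exact ae_summable_disagreement (U := fun k => U (t₀ + k))
      ⟨fun k => hU.measurable _, fun k => hU.stochastic _⟩
      (iIndepFun.precomp (g := fun k => t₀ + k) (add_right_injective t₀) hind) hπpos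
      (fun k => hπ (t₀ + k)) ⟨γ, hγ0, fun k => hγ (t₀ + k)⟩ _
  filter_upwards [h1, h2] with ω hω1 hω2
  refine isErgodicChain_of_solution_single fun t₀ l => ?_
  refine tendsto_sub_of_summable_disagreement (fun k => hU.stochastic (t₀ + k) ω) (fun _ => rfl)
    (hω2 t₀ l) fun S hS hS' => ?_
  -- Dropping the first `t₀` terms does not affect divergence.
  have h := tendsto_atTop_add_const_right atTop (-∑ k ∈ Finset.range t₀, cutFlow (U k ω) S)
    ((tendsto_add_atTop_iff_nat t₀).2 (hω1 S hS hS'))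
  refine h.congr fun n => ?_
  rw [add_comm n, Finset.sum_range_add]
  ring

/-- In an ergodic model the expected flow across every cut is infinite. -/
theorem tendsto_sum_integral_cutFlow_of_isErgodic [IsProbabilityMeasure P] (hU : IsRandomModel U)
    (herg : IsErgodic U P) {S : Finset (Fin m)} (hS : S.Nonempty) (hS' : S ≠ Finset.univ) :
    Tendsto (fun n => ∑ k ∈ Finset.range n, ∫ ω, cutFlow (U k ω) S ∂P) atTop atTop := by
  have h0 (k ω) : 0 ≤ cutFlow (U k ω) S := cutFlow_nonneg (hU.stochastic k ω) S
  by_contra hcon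
  rw [← not_summable_iff_tendsto_nat_atTop_of_nonneg fun k => integral_nonneg (h0 k),
    not_not] at hcon
  have hsum := ae_summable_of_sum_integral_le h0 (fun k => hU.integrable_cutFlow (P := P) k S)
    fun n => hcon.sum_le_tsum _ fun k _ => integral_nonneg (h0 k)
  obtain ⟨ω, h1, h2⟩ := (herg.and hsum).exists
  exact not_isErgodicChain_of_summable_cutFlow (fun k => hU.stochastic k ω) hS hS' h2 h1

end Model

/-! ### The link-failure model inherits the hypotheses on `W`. -/

section LinkFailure

variable {Ω : Type*} {m : ℕ} {W F : ℕ → Ω → Matrix (Fin m) (Fin m) ℝ}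

lemma linkFailureModel_apply (k : ℕ) (ω : Ω) (i j : Fin m) :
    linkFailureModel W F k ω i j =
      W k ω i j * (1 - F k ω i j) + if i = j then ∑ l, W k ω i l * F k ω i l else 0 := by
  rw [linkFailureModel, Matrix.add_apply, Matrix.diagonal_apply]
  simp [Matrix.vecMulVec, Matrix.mulVec, dotProduct, Matrix.hadamard]

lemma linkFailureModel_apply_of_ne (k : ℕ) (ω : Ω) {i j : Fin m} (hij : i ≠ j) :
    linkFailureModel W F k ω i j = W k ω i j * (1 - F k ω i j) := by
  rw [linkFailureModel_apply, if_neg hij, add_zero]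

variable [MeasurableSpace Ω] {P : Measure Ω}

lemma IsUniformLinkFailure.mem_Icc (hF : IsUniformLinkFailure F P) (k : ℕ) (ω : Ω)
    (i j : Fin m) : F k ω i j ∈ Set.Icc (0 : ℝ) 1 := by
  rcases hF.binary k ω i j with h | h <;> simp [h]

lemma isRandomModel_linkFailureModel (hW : IsRandomModel W) (hF : IsUniformLinkFailure F P) :
    IsRandomModel (linkFailureModel W F) where
  measurable k i j := by
    simp only [linkFailureModel_apply]
    have h1 := hW.measurable k
    have h2 := hF.measurable k
    split_ifs <;> fun_prop
  stochastic k ω := by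
    rw [Matrix.mem_rowStochastic_iff_sum]
    refine ⟨fun i j => ?_, fun i => ?_⟩
    · rw [linkFailureModel_apply]
      refine add_nonneg (mul_nonneg (hW.entry_nonneg k ω i j)
        (sub_nonneg.2 (hF.mem_Icc k ω i j).2)) ?_
      split_ifs
      · exact Finset.sum_nonneg fun l _ =>
          mul_nonneg (hW.entry_nonneg k ω i l) (hF.mem_Icc k ω i l).1
      · exact le_rfl
    · simp only [linkFailureModel_apply, Finset.sum_add_distrib, Finset.sum_ite_eq,
        Finset.mem_univ, if_true, mul_sub, mul_one, Finset.sum_sub_distrib, sub_add_cancel]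
      exact Matrix.sum_row_of_mem_rowStochastic (hW.stochastic k ω) i

lemma le_linkFailureModel_diag (hW : IsRandomModel W) (hF : IsUniformLinkFailure F P) (k : ℕ)
    (ω : Ω) (i : Fin m) : W k ω i i ≤ linkFailureModel W F k ω i i := by
  rw [linkFailureModel_apply, if_pos rfl]
  have := Finset.single_le_sum (f := fun l => W k ω i l * F k ω i l)
    (fun l _ => mul_nonneg (hW.entry_nonneg k ω i l) (hF.mem_Icc k ω i l).1) (Finset.mem_univ i)
  linarith

lemma isIndependent_linkFailureModel (hW : IsRandomModel W) (hWindep : IsIndependent W P)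
    (hF : IsUniformLinkFailure F P) (hWF : AreIndependent W F P) :
    IsIndependent (linkFailureModel W F) P := by
  have h := iIndepFun_prodMk (α := fun _ => Fin m → Fin m → ℝ) (β := fun _ => Fin m → Fin m → ℝ)
    hWindep hF.indep_time hWF hW.measurable_fun
    fun k => measurable_pi_lambda _ fun i => measurable_pi_lambda _ fun j => hF.measurable k i j
  have hg : Measurable fun (q : (Fin m → Fin m → ℝ) × (Fin m → Fin m → ℝ)) (i j : Fin m) =>
      q.1 i j * (1 - q.2 i j) + if i = j then ∑ l, q.1 i l * q.2 i l else 0 := by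
    refine measurable_pi_lambda _ fun i => measurable_pi_lambda _ fun j => ?_
    split_ifs <;> fun_prop
  have h' := h.comp _ fun _ => hg
  unfold IsIndependent
  convert h' using 1
  funext k ω i j
  exact linkFailureModel_apply k ω i j

variable [IsProbabilityMeasure P] {p : ℕ → ℝ}

lemma integral_one_sub_linkFailure (hF : IsUniformLinkFailure F P)
    (hp : ∀ k i j, i ≠ j → P.real {ω | F k ω i j = 1} = p k) (k : ℕ) {i j : Fin m} (hij : i ≠ j) :
    ∫ ω, (1 - F k ω i j) ∂P = 1 - p k := by
  have hint : Integrable (fun ω => F k ω i j) P :=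
    .of_mem_Icc 0 1 (hF.measurable k i j).aemeasurable (.of_forall fun ω => hF.mem_Icc k ω i j)
  have hind : (fun ω => F k ω i j) = Set.indicator {ω | F k ω i j = 1} 1 := by
    funext ω
    rcases hF.binary k ω i j with h | h <;> simp [Set.indicator, h]
  rw [integral_sub (integrable_const 1) hint, hind, integral_indicator_one, hp k i j hij]
  · simp
  · exact hF.measurable k i j (measurableSet_singleton 1)

/-- The failure of a link is independent of the matrix `W(k)`, so it factors out of expectations. -/
lemma integral_mul_one_sub_linkFailure (hW : IsRandomModel W) (hF : IsUniformLinkFailure F P)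
    (hWF : AreIndependent W F P) (hp : ∀ k i j, i ≠ j → P.real {ω | F k ω i j = 1} = p k) (k : ℕ)
    {i j : Fin m} (hij : i ≠ j) {f : (Fin m → Fin m → ℝ) → ℝ} (hf : Measurable f) :
    ∫ ω, f (fun i j => W k ω i j) * (1 - F k ω i j) ∂P =
      (1 - p k) * ∫ ω, f (fun i j => W k ω i j) ∂P := by
  have hind : IndepFun (fun ω => f (fun i j => W k ω i j)) (fun ω => 1 - F k ω i j) P :=
    hWF.comp (φ := fun X : ℕ → Fin m → Fin m → ℝ => f (X k))
      (ψ := fun Y : ℕ → Fin m → Fin m → ℝ => 1 - Y k i j) (by fun_prop) (by fun_prop)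
  rw [hind.integral_fun_mul_eq_mul_integral
    (hf.comp (hW.measurable_fun k)).aestronglyMeasurable
    ((hF.measurable k i j).const_sub 1).aestronglyMeasurable,
    integral_one_sub_linkFailure hF hp k hij, mul_comm]

lemma integral_linkFailureModel_of_ne (hW : IsRandomModel W) (hF : IsUniformLinkFailure F P)
    (hWF : AreIndependent W F P) (hp : ∀ k i j, i ≠ j → P.real {ω | F k ω i j = 1} = p k) (k : ℕ)
    {i j : Fin m} (hij : i ≠ j) :
    ∫ ω, linkFailureModel W F k ω i j ∂P = (1 - p k) * ∫ ω, W k ω i j ∂P := by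
  simp only [linkFailureModel_apply_of_ne _ _ hij]
  exact integral_mul_one_sub_linkFailure hW hF hWF hp k hij (f := fun A => A i j) (by fun_prop)

lemma sum_integral_row {U : ℕ → Ω → Matrix (Fin m) (Fin m) ℝ} (hU : IsRandomModel U) (k : ℕ)
    (i : Fin m) : ∑ j, ∫ ω, U k ω i j ∂P = 1 := by
  rw [← integral_finsetSum _ fun j _ => hU.integrable_entry k i j]
  simp [Matrix.sum_row_of_mem_rowStochastic (hU.stochastic k _) i]

/-- Off the diagonal, failures scale expectations by `1 - p k`; the diagonal is then forced, because
rows sum to one on both sides. In this form any `π` fixed by `E[W(k)]` is visibly fixed again. -/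
lemma expectedMatrix_linkFailureModel (hW : IsRandomModel W) (hF : IsUniformLinkFailure F P)
    (hWF : AreIndependent W F P) (hp : ∀ k i j, i ≠ j → P.real {ω | F k ω i j = 1} = p k) (k : ℕ) :
    expectedMatrix (linkFailureModel W F k) P =
      (1 - p k) • expectedMatrix (W k) P + p k • (1 : Matrix (Fin m) (Fin m) ℝ) := by
  ext i j
  simp only [expectedMatrix, Matrix.of_apply, Matrix.add_apply, Matrix.smul_apply, smul_eq_mul]
  rcases eq_or_ne i j with rfl | hij
  · have h1 := sum_integral_row (P := P) (isRandomModel_linkFailureModel hW hF) k i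
    have h2 := sum_integral_row (P := P) hW k i
    rw [← Finset.add_sum_erase _ _ (Finset.mem_univ i)] at h1 h2
    have h3 : ∑ j ∈ Finset.univ.erase i, ∫ ω, linkFailureModel W F k ω i j ∂P =
        (1 - p k) * ∑ j ∈ Finset.univ.erase i, ∫ ω, W k ω i j ∂P := by
      rw [Finset.mul_sum]
      exact Finset.sum_congr rfl fun j hj =>
        integral_linkFailureModel_of_ne hW hF hWF hp k (Finset.ne_of_mem_erase hj).symm
    rw [h3] at h1
    rw [Matrix.one_apply_eq]
    linear_combination h1 - (1 - p k) * h2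
  · rw [integral_linkFailureModel_of_ne hW hF hWF hp k hij, Matrix.one_apply_ne hij]
    ring

lemma hasCommonSteadyState_linkFailureModel (hW : IsRandomModel W)
    (hF : IsUniformLinkFailure F P) (hWF : AreIndependent W F P)
    (hp : ∀ k i j, i ≠ j → P.real {ω | F k ω i j = 1} = p k) {π : Fin m → ℝ}
    (hπ : HasCommonSteadyState W P π) : HasCommonSteadyState (linkFailureModel W F) P π := by
  intro k
  rw [expectedMatrix_linkFailureModel hW hF hWF hp, Matrix.vecMul_add, Matrix.vecMul_smul,
    Matrix.vecMul_smul, hπ k, Matrix.vecMul_one, ← add_smul, sub_add_cancel, one_smul]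

lemma linkFailure_prob_mem_unitInterval (hp : ∀ k i j, i ≠ j → P.real {ω | F k ω i j = 1} = p k) (k : ℕ)
    {i j : Fin m} (hij : i ≠ j) : 0 ≤ p k ∧ p k ≤ 1 :=
  hp k i j hij ▸ ⟨measureReal_nonneg, measureReal_le_one⟩

/-- The same `γ` works: failed weight goes to the diagonal, so `U_ii ≥ W_ii`, and `U_ij = W_ij (1 -
F_ij)` gives `E[U_ii U_ij] ≥ (1 - p k) E[W_ii W_ij]`. The other side of the feedback inequality
scales by exactly `1 - p k`. -/
lemma hasFeedback_linkFailureModel (hW : IsRandomModel W) (hF : IsUniformLinkFailure F P)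
    (hWF : AreIndependent W F P) (hp : ∀ k i j, i ≠ j → P.real {ω | F k ω i j = 1} = p k)
    (hfb : HasFeedback W P) : HasFeedback (linkFailureModel W F) P := by
  obtain ⟨γ, hγ0, hγ⟩ := hfb
  refine ⟨γ, hγ0, fun k i j hij => ?_⟩
  have hU := isRandomModel_linkFailureModel hW hF
  have hpk := linkFailure_prob_mem_unitInterval hp k hij
  have hterm (i j : Fin m) (hij : i ≠ j) : (1 - p k) * ∫ ω, W k ω i i * W k ω i j ∂P ≤
      ∫ ω, linkFailureModel W F k ω i i * linkFailureModel W F k ω i j ∂P := by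
    rw [← integral_mul_one_sub_linkFailure hW hF hWF hp k hij (f := fun A => A i i * A i j)
      (by fun_prop)]
    refine integral_mono_of_nonneg (.of_forall fun ω => ?_) (hU.integrable_entry_mul k i i i j)
      (.of_forall fun ω => ?_)
    · exact mul_nonneg (mul_nonneg (hW.entry_nonneg k ω i i) (hW.entry_nonneg k ω i j))
        (sub_nonneg.2 (hF.mem_Icc k ω i j).2)
    · simp only [linkFailureModel_apply_of_ne _ _ hij]
      rw [mul_assoc]
      exact mul_le_mul_of_nonneg_right (le_linkFailureModel_diag hW hF k ω i)
        (mul_nonneg (hW.entry_nonneg k ω i j) (sub_nonneg.2 (hF.mem_Icc k ω i j).2))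
  have h := hγ k i j hij
  rw [integral_add (hW.integrable_entry k i j) (hW.integrable_entry k j i),
    integral_add (hW.integrable_entry_mul k i i i j) (hW.integrable_entry_mul k j j j i)] at h
  rw [integral_add (hU.integrable_entry k i j) (hU.integrable_entry k j i),
    integral_add (hU.integrable_entry_mul k i i i j) (hU.integrable_entry_mul k j j j i),
    integral_linkFailureModel_of_ne hW hF hWF hp k hij,
    integral_linkFailureModel_of_ne hW hF hWF hp k hij.symm]
  have h' := mul_le_mul_of_nonneg_left h (sub_nonneg.2 hpk.2)
  linarith [hterm i j hij, hterm j i hij.symm]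

lemma integral_cutFlow_linkFailureModel (hW : IsRandomModel W) (hF : IsUniformLinkFailure F P)
    (hWF : AreIndependent W F P) (hp : ∀ k i j, i ≠ j → P.real {ω | F k ω i j = 1} = p k) (k : ℕ)
    (S : Finset (Fin m)) :
    ∫ ω, cutFlow (linkFailureModel W F k ω) S ∂P = (1 - p k) * ∫ ω, cutFlow (W k ω) S ∂P := by
  rw [integral_cutFlow (isRandomModel_linkFailureModel hW hF), integral_cutFlow hW, Finset.mul_sum]
  refine Finset.sum_congr rfl fun i hi => ?_
  rw [Finset.mul_sum]
  refine Finset.sum_congr rfl fun j hj => ?_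
  have hij : i ≠ j := fun h => Finset.mem_compl.1 hj (h ▸ hi)
  rw [integral_linkFailureModel_of_ne hW hF hWF hp k hij,
    integral_linkFailureModel_of_ne hW hF hWF hp k hij.symm, mul_add]

end LinkFailure

/-! ### Almost sure versus expected divergence, and the conclusion. -/

/-- For independent models, weighted flow across a cut diverges almost surely if and only if it
diverges in expectation. -/
lemma ae_tendsto_sum_mul_cutFlow_iff {Ω : Type*} [MeasurableSpace Ω] {P : Measure Ω}
    [IsProbabilityMeasure P] {m : ℕ} {W : ℕ → Ω → Matrix (Fin m) (Fin m) ℝ}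
    (hW : IsRandomModel W) (hWindep : IsIndependent W P) {c : ℕ → ℝ} (hc0 : ∀ k, 0 ≤ c k)
    (hc1 : ∀ k, c k ≤ 1) (S : Finset (Fin m)) :
    (∀ᵐ ω ∂P, Tendsto (fun n => ∑ k ∈ Finset.range n, c k * cutFlow (W k ω) S) atTop atTop) ↔
      Tendsto (fun n => ∑ k ∈ Finset.range n, c k * ∫ ω, cutFlow (W k ω) S ∂P) atTop atTop := by
  have h0 (k ω) : 0 ≤ c k * cutFlow (W k ω) S :=
    mul_nonneg (hc0 k) (cutFlow_nonneg (hW.stochastic k ω) S)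
  simp_rw [← integral_const_mul]
  constructor
  · intro h
    by_contra hcon
    rw [← not_summable_iff_tendsto_nat_atTop_of_nonneg fun k => integral_nonneg (h0 k),
      not_not] at hcon
    have hsum := ae_summable_of_sum_integral_le h0
      (fun k => (hW.integrable_cutFlow (P := P) k S).const_mul (c k))
      fun n => hcon.sum_le_tsum _ fun k _ => integral_nonneg (h0 k)
    obtain ⟨ω, h1, h2⟩ := (h.and hsum).exists
    exact (not_summable_iff_tendsto_nat_atTop_of_nonneg fun k => h0 k ω).2 h1 h2
  · refine ae_tendsto_sum_atTop_of_iIndepFun (M := 2 * m * m)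
      ((iIndepFun_cutFlow hWindep S).comp (fun k y => c k * y) fun k => by fun_prop)
      (fun k => (hW.measurable_cutFlow k S).const_mul _) h0 fun k ω => ?_
    exact (mul_le_of_le_one_left (cutFlow_nonneg (hW.stochastic k ω) S) (hc1 k)).trans
      (cutFlow_le (hW.stochastic k ω) S)

end RandomChain

theorem mainTheorem10 {Ω : Type*} [MeasurableSpace Ω] (P : Measure Ω) [IsProbabilityMeasure P]
    {m : ℕ} (W F : ℕ → Ω → Matrix (Fin m) (Fin m) ℝ) (π : Fin m → ℝ) (p : ℕ → ℝ)
    (hW : RandomChain.IsRandomModel W)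
    (hWindep : RandomChain.IsIndependent W P)
    (hπpos : ∀ i, 0 < π i)
    (hπ : RandomChain.HasCommonSteadyState W P π)
    (hfeedback : RandomChain.HasFeedback W P)
    (hF : RandomChain.IsUniformLinkFailure F P)
    (hWF : RandomChain.AreIndependent W F P)
    (hp : ∀ k i j, i ≠ j → P.real {ω | F k ω i j = 1} = p k) :
    (RandomChain.IsErgodic (RandomChain.linkFailureModel W F) P ↔
      ∀ S : Finset (Fin m), S.Nonempty → S ≠ Finset.univ →
        Tendsto (fun n => ∑ k ∈ Finset.range n,
          (1 - p k) * ∫ ω, RandomChain.cutFlow (W k ω) S ∂P) atTop atTop) ∧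
    (RandomChain.IsErgodic (RandomChain.linkFailureModel W F) P ↔
      ∀ᵐ ω ∂P, ∀ S : Finset (Fin m), S.Nonempty → S ≠ Finset.univ →
        Tendsto (fun n => ∑ k ∈ Finset.range n,
          (1 - p k) * RandomChain.cutFlow (W k ω) S) atTop atTop) := by
  have hU := RandomChain.isRandomModel_linkFailureModel hW hF
  have hUind := RandomChain.isIndependent_linkFailureModel hW hWindep hF hWF
  have hflow := RandomChain.integral_cutFlow_linkFailureModel hW hF hWF hp
  have hexp : RandomChain.IsErgodic (RandomChain.linkFailureModel W F) P ↔
      ∀ S : Finset (Fin m), S.Nonempty → S ≠ Finset.univ →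
        Tendsto (fun n => ∑ k ∈ Finset.range n,
          (1 - p k) * ∫ ω, RandomChain.cutFlow (W k ω) S ∂P) atTop atTop := by
    simp only [← hflow]
    exact ⟨fun h S hS hS' => RandomChain.tendsto_sum_integral_cutFlow_of_isErgodic hU h hS hS',
      RandomChain.isErgodic_of_tendsto_sum_integral_cutFlow hU hUind hπpos
        (RandomChain.hasCommonSteadyState_linkFailureModel hW hF hWF hp hπ)
        (RandomChain.hasFeedback_linkFailureModel hW hF hWF hp hfeedback)⟩
  refine ⟨hexp, hexp.trans ?_⟩
  simp only [ae_all_iff]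
  refine forall_congr' fun S => forall_congr' fun hS => forall_congr' fun hS' => ?_
  -- A proper nonempty `S` supplies a pair `i ≠ j`; only through such a pair is `p k` known to be a
  -- probability, so for `m ≤ 1` nothing is asked of it.
  obtain ⟨i, hi⟩ := hS
  obtain ⟨j, hj⟩ : ∃ j, j ∉ S := by
    by_contra! h
    exact hS' (Finset.eq_univ_iff_forall.2 h)
  have hpk (k) := RandomChain.linkFailure_prob_mem_unitInterval hp k (ne_of_mem_of_not_mem hi hj)
  exact (RandomChain.ae_tendsto_sum_mul_cutFlow_iff hW hWindep (c := fun k => 1 - p k)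
    (fun k => sub_nonneg.2 (hpk k).2) (fun k => sub_le_self 1 (hpk k).1) S).symm
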